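/- **Conventions.** $\mathbb R^n$ carries the Euclidean norm and inner product, and so does $\mathbb R^n\times\mathbb R^n=\mathbb R^{2n}$. For $h:\mathbb R^m\to[-\infty,+\infty]$ and a point $\bar x$ with $h(\bar x)$ finite, the Fréchet subdifferential is $$\widehat\partial h(\bar x)=\Big\{\zeta:\ \liminf_{x\to\bar x,\,x\ne\bar x}\frac{h(x)-h(\bar x)-\langle\zeta,x-\bar x\rangle}{\|x-\bar x\|}\ge 0\Big\},$$ and the limiting subdifferential $\partial h(\bar x)$ is the set of all $\zeta$ for which there are $x^k\to\bar x$ and $\zeta^k\in\widehat\partial h(x^k)$ with $h(x^k)\to h(\bar x)$ and $\zeta^k\to\zeta$; $\mathrm{Dom}\,\partial h$ is the set of points where $\partial h\neq\emptyset$. A proper lower semicontinuous function $h$ has the *KL property with exponent* $\theta\in[0,1)$ at $\bar x\in\mathrm{Dom}\,\partial h$ if there are $r>0$, $\eta\in(0,+\infty]$ and $c>0$ such that, with $\phi(t)=c\,t^{1-\theta}$, $$\phi'\big(|h(x)-h(\bar x)|\big)\,\mathrm{dist}\big(0,\partial h(x)\big)\ge 1$$ for all $x\in\mathrm{Dom}\,\partial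 h$ with $\|x-\bar x\|<r$ and $0<|h(x)-h(\bar x)|<\eta$. **Setting.** Let $p>1$ and $L_p>0$. Let $f:\mathbb R^n\to\mathbb R$ be Fréchet differentiable with $$f(y)\le f(x)+\langle\zeta,y-x\rangle+\tfrac{L_p}{p}\|y-x\|^p\qquad\text{for all }x,y\in\mathbb R^n,\ \zeta\in\partial f(x).$$ Let $g:\mathbb R^n\to(-\infty,+\infty]$ be proper and lower semicontinuous, and suppose that $g$ is high-order prox-bounded of order $p$: there are $\gamma>0$ and $x\in\mathbb R^n$ with $\inf_y\{g(y)+\frac1{p\gamma}\|x-y\|^p\}>-\infty$; let $\gamma^{g,p}\in(0,+\infty]$ be the supremum of all such $\gamma$. Put $\varphi=f+g$ and suppose that $\varphi$ attains its minimum over $\mathbb R^n$. Let $$\ell(x,y)=f(x)+\langle\nabla f(x),y-x\rangle+g(y),$$ $$T_{\gamma}(x)=\operatorname*{arg\,min}_{y\in\mathbb R^n}\Big\{\ell(x,y)+\tfrac1{p\gamma}\|x-y\|^p\Big\},\qquad \varphi_{\gamma}(x)=\inf_{y\in\mathbb R^n}\Big\{\ell(x,y)+\tfrac1{p\gamma}\|x-y\|^p\Big\},$$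 the latter being the high-order forward-backward envelope (HiFBE) of $\varphi$ with parameter $\gamma>0$. **Proposition 5.5 (KL property of HiFBE).** Let $\theta\in\left[\frac{p-1}{p},1\right)$, and suppose that $\ell$ has the KL property with exponent $\theta$ at each point $(x,x)\in\mathrm{Dom}\,\partial\ell$ such that $0\in\widehat\partial\varphi(x)$. Let $\widehat\gamma>0$, let $\bar x\in\mathrm{dom}\,\varphi$ be a proximal fixed point, $\bar x\in T_{\widehat\gamma}(\bar x)$, and suppose that $f$ is twice continuously differentiable in a neighbourhood of $\bar x$. Then, for every $\gamma\in\left(0,\min\{L_p^{-1},\gamma^{g,p},\widehat\gamma\}\right)$, the function $\varphi_\gamma$ has the KL property with exponent $\theta$ at $\bar x$. -/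

import Mathlib

open Filter Topology
open scoped Gradient

noncomputable section

namespace HiFB

section General

variable {V : Type*} [NormedAddCommGroup V] [InnerProductSpace ℝ V]

/-- An extended-real-valued function is proper if it never takes the value `-∞` and is not
identically `+∞`. -/
def IsProper (h : V → EReal) : Prop :=
  (∀ x, h x ≠ ⊥) ∧ ∃ x, h x ≠ ⊤

/-- The Fréchet (regular) subdifferential of `h` at `x` (empty where `h x` is not finite).  The
condition says `liminf_{y → x, y ≠ x} (h y - h x - ⟪ζ, y - x⟫) / ‖y - x‖ ≥ 0`, written without
quotients of extended reals. -/
def frechetSubdifferential (h : V → EReal) (x : V) : Set V :=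
  {ζ | h x ≠ ⊤ ∧ h x ≠ ⊥ ∧
    ∀ ε : ℝ, 0 < ε → ∀ᶠ y in 𝓝 x,
      h x + ((inner ℝ ζ (y - x) - ε * ‖y - x‖ : ℝ) : EReal) ≤ h y}

/-- The Mordukhovich (limiting) subdifferential of `h` at `x`
(empty where `h x` is not finite). -/
def limitingSubdifferential (h : V → EReal) (x : V) : Set V :=
  {ζ | h x ≠ ⊤ ∧ h x ≠ ⊥ ∧ ∃ (u : ℕ → V) (v : ℕ → V),
    Tendsto u atTop (𝓝 x) ∧ (∀ k, v k ∈ frechetSubdifferential h (u k)) ∧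
    Tendsto (fun k => h (u k)) atTop (𝓝 (h x)) ∧ Tendsto v atTop (𝓝 ζ)}

/-- The domain of the limiting subdifferential, as a set-valued map. -/
def domSubdifferential (h : V → EReal) : Set V :=
  {x | (limitingSubdifferential h x).Nonempty}

/-- The set of Fréchet critical points of `h`. -/
def frechetCritical (h : V → EReal) : Set V :=
  {x | 0 ∈ frechetSubdifferential h x}

/-- The Kurdyka-Łojasiewicz inequality (absolute value version) for `h` near `xbar`, with
the desingularizing function `φ`.  At points of `domSubdifferential h` the function `h` is finite,
so `EReal.toReal` does not lose anything, and the set whose distance to `0` is taken is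
nonempty. -/
def KLInequality (h : V → EReal) (xbar : V) (φ : ℝ → ℝ) : Prop :=
  ∃ r : ℝ, 0 < r ∧ ∃ η : EReal, 0 < η ∧
    ∀ x ∈ Metric.ball xbar r, x ∈ domSubdifferential h →
      0 < |(h x).toReal - (h xbar).toReal| →
      ((|(h x).toReal - (h xbar).toReal| : ℝ) : EReal) < η →
      1 ≤ deriv φ |(h x).toReal - (h xbar).toReal| *
        Metric.infDist 0 (limitingSubdifferential h x)

/-- `h` is a proper lower semicontinuous function with the Kurdyka-Łojasiewicz property at
`xbar ∈ Dom ∂h` with exponent `θ ∈ [0, 1)`: the desingularizing function is `t ↦ c t ^ (1 - θ)`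
for some `c > 0`. -/
def KLExponentAt (h : V → EReal) (xbar : V) (θ : ℝ) : Prop :=
  IsProper h ∧ LowerSemicontinuous h ∧ xbar ∈ domSubdifferential h ∧
    0 ≤ θ ∧ θ < 1 ∧
    ∃ c : ℝ, 0 < c ∧ KLInequality h xbar (fun t => c * t ^ (1 - θ))

/-- `f` is continuous and possesses a high-order majorant with power `p > 1` and
constant `L > 0`. -/
def HasHighOrderMajorant (f : V → ℝ) (p L : ℝ) : Prop :=
  1 < p ∧ 0 < L ∧ Continuous f ∧
    ∀ x y : V, ∀ ζ ∈ limitingSubdifferential (fun z => (f z : EReal)) x,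
      f y ≤ f x + inner ℝ ζ (y - x) + L / p * ‖y - x‖ ^ p

/-- The high-order Moreau envelope of `g` of order `p` with parameter `γ`. -/
def highOrderMoreauEnvelope (g : V → EReal) (p γ : ℝ) (x : V) : EReal :=
  ⨅ y : V, g y + ((1 / (p * γ) * ‖x - y‖ ^ p : ℝ) : EReal)

/-- The set of parameters `γ > 0` at which the envelope is `> -∞` for some point. -/
def proxBoundParams (g : V → EReal) (p : ℝ) : Set ℝ :=
  {γ | 0 < γ ∧ ∃ x : V, ⊥ < highOrderMoreauEnvelope g p γ x}

/-- High-order prox-boundedness with order `p`. -/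
def HighOrderProxBounded (g : V → EReal) (p : ℝ) : Prop :=
  (proxBoundParams g p).Nonempty

/-- The threshold of high-order prox-boundedness, a supremum in `[-∞, +∞]`. -/
def proxThreshold (g : V → EReal) (p : ℝ) : EReal :=
  ⨆ γ ∈ proxBoundParams g p, (γ : EReal)

variable [CompleteSpace V]

/-- The objective `f + g`. -/
def objective (f : V → ℝ) (g : V → EReal) (x : V) : EReal :=
  (f x : EReal) + g x

/-- The auxiliary function `ℓ (x, y) = f x + ⟪∇ f x, y - x⟫ + g y`, on the product `V × V` with its
Euclidean (`L²`) norm and inner product. -/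
def ell (f : V → ℝ) (g : V → EReal) (z : WithLp 2 (V × V)) : EReal :=
  ((f z.fst + inner ℝ (∇ f z.fst) (z.snd - z.fst) : ℝ) : EReal) + g z.snd

/-- The function `y ↦ ℓ (x, y) + (1 / (p γ)) ‖x - y‖ ^ p` minimized in one forward-backward
step from `x`. -/
def hifbModel (f : V → ℝ) (g : V → EReal) (p γ : ℝ) (x y : V) : EReal :=
  ell f g (WithLp.toLp 2 (x, y)) + ((1 / (p * γ) * ‖x - y‖ ^ p : ℝ) : EReal)

/-- The high-order forward-backward splitting mapping: the set of minimizers of the model. -/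
def hifbs (f : V → ℝ) (g : V → EReal) (p γ : ℝ) (x : V) : Set V :=
  {y | ∀ z : V, hifbModel f g p γ x y ≤ hifbModel f g p γ x z}

/-- The high-order forward-backward envelope. -/
def hifbe (f : V → ℝ) (g : V → EReal) (p γ : ℝ) (x : V) : EReal :=
  ⨅ y : V, hifbModel f g p γ x y

/-- The set of proximal fixed points: points of `dom (f + g)` that are fixed points of the
splitting mapping. -/
def proxFixedPoints (f : V → ℝ) (g : V → EReal) (p γ : ℝ) : Set V :=
  {x | objective f g x ≠ ⊤ ∧ x ∈ hifbs f g p γ x}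

end General

end HiFB

end

/-! Take `x` near `x₀ = xbar`, `y` in the splitting map at `x`, and `v` a Fréchet subgradient of the
envelope at `x`. The model lies above the envelope and touches it at `(x, y)`, so `(v, 0)` is a
subgradient of the model. Removing the smooth power leaves `(v - w, w)` as a subgradient of `ell`,
where `w = γ⁻¹ ‖x - y‖ ^ (p - 2) (x - y)` has norm `γ⁻¹ ‖x - y‖ ^ (p - 1)`
(`toLp_mem_frechetSubdifferential_ell`). The KL inequality of `ell` then bounds its gap to the power
`θ` by a multiple of `‖v‖ + ‖x - y‖ ^ (p - 1)`. The envelope gap has the extra term `‖x - y‖ ^ p /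
(p γ)`, whose power `θ` is also of order `‖x - y‖ ^ (p - 1)`, because `p θ ≥ p - 1`.

It remains to bound `‖x - y‖ ^ (p - 1)` by a multiple of `‖v‖`
(`exists_mul_rpow_le_norm_subgradient`): moving `x` towards `y` with `y` fixed lowers the proximal
term at a rate that the variation of `∇ f` cannot cancel, since `γ < 1 / L`.

The fixed point for the larger parameter gives `g` a lower bound at `x₀` with power coefficient
below `1 / (p γ)`. Hence steps from nearby points stay near `x₀`, and `0` is a subgradient of the
envelope there, which makes the KL hypothesis on `ell` applicable. Limiting subgradients are reached
by passing to the limit. -/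

namespace HiFB

/-! ### Scalar inequalities for powers. -/

section Scalar

/-- A power of a sum is controlled by a slightly larger multiple of the power of one summand, up to
a multiple of the power of the other. -/
lemma exists_mul_add_rpow_le {p a b : ℝ} (hp : 1 < p) (hb : 0 ≤ b) (hab : b < a) :
    ∃ C : ℝ, 0 ≤ C ∧ ∀ u R : ℝ, 0 ≤ u → 0 ≤ R → b * (u + R) ^ p ≤ a * u ^ p + C * R ^ p := by
  have hcont : ContinuousAt (fun t : ℝ => b * (1 + t) ^ p) 0 := by
    have : ContinuousAt (fun t : ℝ => (1 + t) ^ p) 0 :=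
      ContinuousAt.rpow_const (by fun_prop) (Or.inr (by linarith))
    exact this.const_mul b
  have hlt : ∀ᶠ t in 𝓝 (0 : ℝ), b * (1 + t) ^ p < a := by
    apply hcont.eventually_lt_const
    simpa using hab
  obtain ⟨δ, hδ, hball⟩ := Metric.eventually_nhds_iff.1 hlt
  have hδ2 : b * (1 + δ / 2) ^ p < a := hball (by
    rw [Real.dist_eq, sub_zero, abs_of_pos (by linarith)]; linarith)
  have hδ' : 0 < δ / 2 := by linarith
  generalize δ / 2 = e at hδ2 hδ'
  refine ⟨b * (1 + 1 / e) ^ p, by positivity, fun u R hu hR => ?_⟩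
  -- Either `R` is absorbed into `(1 + e) u`, or `u` is at most `R / e` and the whole sum is a
  -- multiple of `R`.
  rcases le_total R (e * u) with h | h
  · have h1 : (u + R) ^ p ≤ ((1 + e) * u) ^ p :=
      Real.rpow_le_rpow (by positivity) (by linarith) (by linarith)
    rw [Real.mul_rpow (by positivity) hu] at h1
    have h2 : b * (u + R) ^ p ≤ b * ((1 + e) ^ p * u ^ p) := mul_le_mul_of_nonneg_left h1 hb
    have h3 : b * (1 + e) ^ p * u ^ p ≤ a * u ^ p :=
      mul_le_mul_of_nonneg_right hδ2.le (by positivity)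
    have h4 : 0 ≤ b * (1 + 1 / e) ^ p * R ^ p := by positivity
    linarith
  · have h0 : u ≤ 1 / e * R := by
      rw [one_div, inv_mul_eq_div, le_div_iff₀ hδ']; linarith
    have h1 : (u + R) ^ p ≤ ((1 + 1 / e) * R) ^ p :=
      Real.rpow_le_rpow (by positivity) (by linarith) (by linarith)
    rw [Real.mul_rpow (by positivity) hR] at h1
    have h2 : b * (u + R) ^ p ≤ b * ((1 + 1 / e) ^ p * R ^ p) := mul_le_mul_of_nonneg_left h1 hb
    have h3 : 0 ≤ a * u ^ p := mul_nonneg (by linarith) (by positivity)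
    linarith

/-- A power with exponent greater than one eventually dominates an affine function. -/
lemma eventually_affine_lt_mul_rpow {p c : ℝ} (hp : 1 < p) (hc : 0 < c) (G B : ℝ) :
    ∀ᶠ s : ℝ in atTop, G * s + B < c * s ^ p := by
  have h := tendsto_rpow_atTop (show 0 < p - 1 by linarith)
  filter_upwards [h.eventually_gt_atTop ((|G| + |B|) / c), eventually_ge_atTop 1] with s hs hs1
  rw [div_lt_iff₀ hc] at hs
  have hs0 : 0 < s := by linarith
  have e : s ^ p = s ^ (p - 1) * s := by
    rw [← Real.rpow_add_one hs0.ne']; simp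
  rw [e]
  have h1 : (|G| + |B|) * s < s ^ (p - 1) * c * s := mul_lt_mul_of_pos_right hs hs0
  have h2 : G * s ≤ |G| * s := mul_le_mul_of_nonneg_right (le_abs_self G) hs0.le
  have h3 : B ≤ |B| * s := (le_abs_self B).trans (le_mul_of_one_le_right (abs_nonneg B) hs1)
  nlinarith

end Scalar

/-! ### Differentiability, the majorant and continuity of the gradient. -/

section Subdifferential

variable {V : Type*} [NormedAddCommGroup V] [InnerProductSpace ℝ V]

lemma frechetSubdifferential_subset_limitingSubdifferential (h : V → EReal) (x : V) :
    frechetSubdifferential h x ⊆ limitingSubdifferential h x := fun ζ hζ =>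
  ⟨hζ.1, hζ.2.1, fun _ => x, fun _ => ζ, tendsto_const_nhds, fun _ => hζ, tendsto_const_nhds,
    tendsto_const_nhds⟩

variable [CompleteSpace V]

lemma eventually_abs_sub_sub_inner_gradient_le {f : V → ℝ} {x : V} (hf : DifferentiableAt ℝ f x)
    {ε : ℝ} (hε : 0 < ε) :
    ∀ᶠ y in 𝓝 x, |f y - f x - inner ℝ (∇ f x) (y - x)| ≤ ε * ‖y - x‖ := by
  have h := (hasGradientAt_iff_isLittleO.1 hf.hasGradientAt).bound hε
  simpa [Real.norm_eq_abs] using h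

lemma gradient_mem_frechetSubdifferential {f : V → ℝ} {x : V} (hf : DifferentiableAt ℝ f x) :
    ∇ f x ∈ frechetSubdifferential (fun z => (f z : EReal)) x := by
  refine ⟨EReal.coe_ne_top _, EReal.coe_ne_bot _, fun ε hε => ?_⟩
  filter_upwards [eventually_abs_sub_sub_inner_gradient_le hf hε] with y hy
  rw [← EReal.coe_add, EReal.coe_le_coe_iff]
  have := neg_le_of_abs_le hy
  linarith

lemma HasHighOrderMajorant.le {f : V → ℝ} {p L : ℝ} (h : HasHighOrderMajorant f p L)
    (hf : Differentiable ℝ f) (x y : V) :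
    f y ≤ f x + inner ℝ (∇ f x) (y - x) + L / p * ‖y - x‖ ^ p :=
  h.2.2.2 x y _ (frechetSubdifferential_subset_limitingSubdifferential _ _
    (gradient_mem_frechetSubdifferential (hf x)))

/-- The gradient of a differentiable function with a high-order majorant is continuous. -/
lemma HasHighOrderMajorant.continuous_gradient {f : V → ℝ} {p L : ℝ}
    (h : HasHighOrderMajorant f p L) (hf : Differentiable ℝ f) : Continuous (∇ f) := by
  have hp := h.1
  have hL := h.2.1
  rw [continuous_iff_continuousAt]
  intro x₀
  rw [Metric.continuousAt_iff']
  intro ε hε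
  have hε6 : 0 < ε / 6 := by linarith
  obtain ⟨δ, hδ, hball⟩ := Metric.eventually_nhds_iff.1
    (eventually_abs_sub_sub_inner_gradient_le (hf x₀) hε6)
  have hpow : ∀ᶠ x in 𝓝 x₀, L / p * ‖x - x₀‖ ^ (p - 1) < ε / 6 := by
    have hc : ContinuousAt (fun x : V => L / p * ‖x - x₀‖ ^ (p - 1)) x₀ := by
      have : ContinuousAt (fun x : V => ‖x - x₀‖ ^ (p - 1)) x₀ :=
        ContinuousAt.rpow_const (by fun_prop) (Or.inr (by linarith))
      exact this.const_mul _
    apply hc.eventually_lt_const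
    simpa [Real.zero_rpow (by linarith : p - 1 ≠ 0)] using hε
  filter_upwards [hpow, Metric.ball_mem_nhds x₀ (show 0 < δ / 3 by linarith)] with x hx hxδ
  rw [dist_eq_norm]
  set w := ∇ f x - ∇ f x₀ with hw
  rcases eq_or_ne w 0 with hw0 | hw0
  · simpa [hw0] using hε
  rcases eq_or_ne x x₀ with rfl | hne
  · simp [hw] at hw0
  have hwn : 0 < ‖w‖ := norm_pos_iff.2 hw0
  set t := ‖x - x₀‖ with ht
  have ht0 : 0 < t := norm_pos_iff.2 (sub_ne_zero.2 hne)
  rw [Metric.mem_ball, dist_eq_norm, ← ht] at hxδ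
  -- Test point `x - u`, at distance `t` from `x` against the gradient difference `w`. The majorant
  -- at `x` bounds `f (x - u)` above and differentiability at `x₀` bounds it below; the comparison
  -- isolates `t * ‖w‖`. The radius `δ / 3` suffices as `x - u` is within `2 t` of `x₀`.
  set u := (t / ‖w‖) • w with hu
  have hun : ‖u‖ = t := by
    rw [hu, norm_smul, Real.norm_of_nonneg (by positivity)]; field_simp
  have hnorm : ‖x - u - x₀‖ ≤ 2 * t := by
    have : x - u - x₀ = (x - x₀) - u := by abel
    rw [this]; exact (norm_sub_le _ _).trans (by rw [hun]; linarith)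
  have h1 := h.le hf x (x - u)
  have h2 := neg_le_of_abs_le (hball (show dist (x - u) x₀ < δ by rw [dist_eq_norm]; linarith))
  have h3 := le_of_abs_le (hball (show dist x x₀ < δ by rw [dist_eq_norm]; linarith))
  have e1 : x - u - x = -u := by abel
  have e2 : inner ℝ (∇ f x₀) (x - u - x₀) = inner ℝ (∇ f x₀) (x - x₀) - inner ℝ (∇ f x₀) u := by
    rw [← inner_sub_right]; congr 1; abel
  rw [e1, norm_neg, hun, inner_neg_right] at h1
  rw [e2] at h2
  have e3 : inner ℝ (∇ f x) u - inner ℝ (∇ f x₀) u = t * ‖w‖ := by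
    rw [← inner_sub_left, ← hw, hu, inner_smul_right, real_inner_self_eq_norm_sq]; field_simp
  have e4 : t ^ p = t ^ (p - 1) * t := by
    rw [← Real.rpow_add_one ht0.ne']; simp
  have h4 : L / p * t ^ p ≤ ε / 6 * t := by
    rw [e4, ← mul_assoc]; exact mul_le_mul_of_nonneg_right hx.le ht0.le
  have h5 : t * ‖w‖ ≤ t * (ε / 6 * 4) := by nlinarith
  have := le_of_mul_le_mul_left h5 ht0
  linarith

end Subdifferential

/-! ### Coercivity of the model; the envelope is proper and lower semicontinuous. -/

section Model

variable {V : Type*} [NormedAddCommGroup V]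

/-- Some admissible parameter exceeds `γ`, which makes the coefficient `b` strictly smaller than `1
/ (p * γ)`. -/
lemma exists_prox_lower_bound {g : V → EReal} (hg : IsProper g) {p γ : ℝ} (hp : 1 < p)
    (hγ : 0 < γ) (hlt : (γ : EReal) < proxThreshold g p) :
    ∃ b m : ℝ, 0 ≤ b ∧ b < 1 / (p * γ) ∧ ∃ x₀ : V, ∀ y,
      ((m - b * ‖x₀ - y‖ ^ p : ℝ) : EReal) ≤ g y := by
  obtain ⟨γ', h1⟩ := lt_iSup_iff.1 hlt
  obtain ⟨⟨hγ', x₀, hx₀⟩, h2⟩ := lt_iSup_iff.1 h1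
  rw [EReal.coe_lt_coe_iff] at h2
  obtain ⟨m, -, hm⟩ := EReal.lt_iff_exists_real_btwn.1 hx₀
  refine ⟨1 / (p * γ'), m, by positivity, ?_, x₀, fun y => ?_⟩
  · apply one_div_lt_one_div_of_lt (by positivity)
    exact mul_lt_mul_of_pos_left h2 (by linarith)
  · have h3 : (m : EReal) ≤ g y + ((1 / (p * γ') * ‖x₀ - y‖ ^ p : ℝ) : EReal) :=
      hm.le.trans (iInf_le _ y)
    induction hgy : g y with
    | bot => exact absurd hgy (hg.1 y)
    | top => exact le_top
    | coe r =>
      rw [hgy, ← EReal.coe_add, EReal.coe_le_coe_iff] at h3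
      rw [EReal.coe_le_coe_iff]; linarith

variable [InnerProductSpace ℝ V] [CompleteSpace V]

lemma hifbModel_eq (f : V → ℝ) (g : V → EReal) (p γ : ℝ) (x y : V) :
    hifbModel f g p γ x y =
      ((f x + inner ℝ (∇ f x) (y - x) + 1 / (p * γ) * ‖x - y‖ ^ p : ℝ) : EReal) + g y := by
  simp only [hifbModel, ell]
  rw [EReal.coe_add (f x + inner ℝ (∇ f x) (y - x)), add_right_comm]
  rfl

lemma hifbe_le_hifbModel (f : V → ℝ) (g : V → EReal) (p γ : ℝ) (x y : V) :
    hifbe f g p γ x ≤ hifbModel f g p γ x y := iInf_le _ y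

lemma hifbe_eq_of_mem_hifbs {f : V → ℝ} {g : V → EReal} {p γ : ℝ} {x y : V}
    (hy : y ∈ hifbs f g p γ x) : hifbe f g p γ x = hifbModel f g p γ x y :=
  le_antisymm (iInf_le _ y) (le_iInf hy)

lemma hifbModel_ne_bot {f : V → ℝ} {g : V → EReal} (hg : IsProper g) (p γ : ℝ) (x y : V) :
    hifbModel f g p γ x y ≠ ⊥ := by
  rw [hifbModel_eq]
  exact (EReal.bot_lt_add_iff.2 ⟨EReal.bot_lt_coe _, bot_lt_iff_ne_bot.2 (hg.1 y)⟩).ne'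

lemma hifbe_ne_top {f : V → ℝ} {g : V → EReal} (hg : IsProper g) (p γ : ℝ) (x : V) :
    hifbe f g p γ x ≠ ⊤ := by
  obtain ⟨y, hy⟩ := hg.2
  apply ne_top_of_le_ne_top _ (hifbe_le_hifbModel f g p γ x y)
  rw [hifbModel_eq]
  exact EReal.add_ne_top (EReal.coe_ne_top _) hy

/-- The model is coercive in its second argument, locally uniformly in the first one. -/
lemma exists_forall_lt_hifbModel {f : V → ℝ} {g : V → EReal} {p γ : ℝ} (hp : 1 < p)
    (hfc : Continuous f) (hfg : Continuous (∇ f)) (hg : IsProper g) (hγ : 0 < γ)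
    (hlt : (γ : EReal) < proxThreshold g p) (x₁ : V) (B : ℝ) :
    ∃ R : ℝ, ∀ᶠ x in 𝓝 x₁, ∀ y, R < ‖y - x₁‖ → (B : EReal) < hifbModel f g p γ x y := by
  obtain ⟨b, m, hb0, hb, x₀, hbound⟩ := exists_prox_lower_bound hg hp hγ hlt
  set a := 1 / (p * γ) with ha
  -- Half of the gap `a - b` pays for moving the centre from `x₀` to `x`; the other half beats the
  -- affine terms.
  obtain ⟨C, hC0, hC⟩ := exists_mul_add_rpow_le hp hb0 (show b < (a + b) / 2 by linarith)
  have hev := eventually_affine_lt_mul_rpow hp (show 0 < (a - b) / 2 by linarith)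
    (‖∇ f x₁‖ + 1) (B - (f x₁ - 1) - m + C * (‖x₁ - x₀‖ + 1) ^ p)
  obtain ⟨S, hS⟩ := eventually_atTop.1 hev
  refine ⟨S + 1, ?_⟩
  have e1 : ∀ᶠ x in 𝓝 x₁, f x₁ - 1 < f x := hfc.continuousAt.eventually_const_lt (by linarith)
  have e2 : ∀ᶠ x in 𝓝 x₁, ‖∇ f x‖ < ‖∇ f x₁‖ + 1 :=
    hfg.norm.continuousAt.eventually_lt_const (by linarith)
  filter_upwards [e1, e2, Metric.ball_mem_nhds x₁ one_pos] with x h1 h2 h3 y hy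
  rw [Metric.mem_ball, dist_eq_norm] at h3
  have hs : S ≤ ‖x - y‖ := by
    have : ‖y - x₁‖ ≤ ‖x - y‖ + ‖x - x₁‖ := by
      rw [show y - x₁ = (x - x₁) - (x - y) by abel]
      exact (norm_sub_le _ _).trans (by linarith)
    linarith
  have h4 := hS _ hs
  have h5 : ‖x₀ - y‖ ≤ ‖x - y‖ + (‖x₁ - x₀‖ + 1) := by
    rw [show x₀ - y = (x - y) - (x - x₁) - (x₁ - x₀) by abel]
    exact (norm_sub_le _ _).trans (by linarith [norm_sub_le (x - y) (x - x₁)])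
  have h6 : b * ‖x₀ - y‖ ^ p ≤ b * (‖x - y‖ + (‖x₁ - x₀‖ + 1)) ^ p :=
    mul_le_mul_of_nonneg_left (Real.rpow_le_rpow (norm_nonneg _) h5 (by linarith)) hb0
  have h7 := hC ‖x - y‖ (‖x₁ - x₀‖ + 1) (norm_nonneg _) (by positivity)
  have h8 : -(‖∇ f x₁‖ + 1) * ‖x - y‖ ≤ inner ℝ (∇ f x) (y - x) := by
    have := neg_le_of_abs_le (abs_real_inner_le_norm (∇ f x) (y - x))
    rw [norm_sub_rev y x] at this
    nlinarith [mul_le_mul_of_nonneg_right h2.le (norm_nonneg (x - y))]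
  rw [hifbModel_eq]
  refine lt_of_lt_of_le ?_ (add_le_add le_rfl (hbound y))
  rw [← EReal.coe_add, EReal.coe_lt_coe_iff]
  linarith

lemma lowerSemicontinuous_hifbModel {f : V → ℝ} {g : V → EReal} {p γ : ℝ} (hp : 1 < p)
    (hfc : Continuous f) (hfg : Continuous (∇ f)) (hglsc : LowerSemicontinuous g) :
    LowerSemicontinuous fun z : V × V => hifbModel f g p γ z.1 z.2 := by
  simp only [hifbModel_eq]
  have hc : Continuous fun z : V × V =>
      f z.1 + inner ℝ (∇ f z.1) (z.2 - z.1) + 1 / (p * γ) * ‖z.1 - z.2‖ ^ p := by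
    have h1 : Continuous fun z : V × V => ‖z.1 - z.2‖ ^ p :=
      Continuous.rpow_const (by fun_prop) fun _ => Or.inr (by linarith)
    fun_prop
  refine LowerSemicontinuous.add' (continuous_coe_real_ereal.comp hc).lowerSemicontinuous
    (hglsc.comp continuous_snd) fun z => ?_
  exact EReal.continuousAt_add (Or.inl (EReal.coe_ne_top _)) (Or.inl (EReal.coe_ne_bot _))

variable [ProperSpace V]

lemma hifbs_nonempty {f : V → ℝ} {g : V → EReal} {p γ : ℝ} (hp : 1 < p)
    (hfc : Continuous f) (hfg : Continuous (∇ f)) (hg : IsProper g)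
    (hglsc : LowerSemicontinuous g) (hγ : 0 < γ)
    (hlt : (γ : EReal) < proxThreshold g p) (x : V) : (hifbs f g p γ x).Nonempty := by
  obtain ⟨B, hB, -⟩ := EReal.lt_iff_exists_real_btwn.1 (lt_top_iff_ne_top.2
    (hifbe_ne_top (f := f) hg p γ x))
  obtain ⟨R, hR⟩ := exists_forall_lt_hifbModel hp hfc hfg hg hγ hlt x B
  have hR := hR.self_of_nhds
  obtain ⟨y₀, hy₀⟩ := iInf_lt_iff.1 hB
  have hy₀R : y₀ ∈ Metric.closedBall x R := by
    rw [Metric.mem_closedBall, dist_eq_norm]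
    by_contra hcon
    exact absurd (hR y₀ (not_le.1 hcon)) (not_lt.2 hy₀.le)
  have hlsc : LowerSemicontinuous fun y => hifbModel f g p γ x y :=
    (lowerSemicontinuous_hifbModel (γ := γ) hp hfc hfg hglsc).comp
      (Continuous.prodMk_right x)
  obtain ⟨y, hyR, hy⟩ := (hlsc.lowerSemicontinuousOn _).exists_isMinOn ⟨y₀, hy₀R⟩
    (isCompact_closedBall x R)
  refine ⟨y, fun z => ?_⟩
  by_cases hz : z ∈ Metric.closedBall x R
  · exact hy hz
  · rw [Metric.mem_closedBall, dist_eq_norm, not_le] at hz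
    exact (hy hy₀R).trans (hy₀.le.trans (hR z hz).le)

lemma isProper_hifbe {f : V → ℝ} {g : V → EReal} {p γ : ℝ} (hp : 1 < p)
    (hfc : Continuous f) (hfg : Continuous (∇ f)) (hg : IsProper g)
    (hglsc : LowerSemicontinuous g) (hγ : 0 < γ)
    (hlt : (γ : EReal) < proxThreshold g p) : IsProper (hifbe f g p γ) := by
  refine ⟨fun x => ?_, 0, hifbe_ne_top hg p γ 0⟩
  obtain ⟨y, hy⟩ := hifbs_nonempty hp hfc hfg hg hglsc hγ hlt x
  rw [hifbe_eq_of_mem_hifbs hy]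
  exact hifbModel_ne_bot hg p γ x y

/-- Coercivity disposes of all `y` outside one closed ball, uniformly for `x` near `x₁`. On that
compact ball, the tube lemma propagates the strict bound on the model from `x₁` to its neighbours.
-/
lemma lowerSemicontinuous_hifbe {f : V → ℝ} {g : V → EReal} {p γ : ℝ} (hp : 1 < p)
    (hfc : Continuous f) (hfg : Continuous (∇ f)) (hg : IsProper g)
    (hglsc : LowerSemicontinuous g) (hγ : 0 < γ)
    (hlt : (γ : EReal) < proxThreshold g p) : LowerSemicontinuous (hifbe f g p γ) := by
  intro x₁ B hB
  obtain ⟨B', hBB', hB'⟩ := EReal.lt_iff_exists_real_btwn.1 hB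
  obtain ⟨R, hR⟩ := exists_forall_lt_hifbModel hp hfc hfg hg hγ hlt x₁ B'
  have hopen := (lowerSemicontinuous_hifbModel (γ := γ) hp hfc hfg hglsc).isOpen_preimage B'
  obtain ⟨u, v, hu, -, hxu, hv, huv⟩ := generalized_tube_lemma (isCompact_singleton (x := x₁))
    (isCompact_closedBall x₁ R) hopen (by
      rintro ⟨x, y⟩ ⟨hx, -⟩
      rw [Set.mem_singleton_iff] at hx
      simp only at hx
      subst hx
      exact lt_of_lt_of_le hB' (hifbe_le_hifbModel f g p γ x y))
  filter_upwards [hR, hu.mem_nhds (hxu rfl)] with x h1 h2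
  refine lt_of_lt_of_le hBB' (le_iInf fun y => ?_)
  by_cases hy : y ∈ Metric.closedBall x₁ R
  · exact (huv (Set.mk_mem_prod h2 (hv hy))).le
  · rw [Metric.mem_closedBall, dist_eq_norm, not_le] at hy
    exact (h1 y hy).le

end Model

/-! ### Behaviour of the model and of the steps near a proximal fixed point. -/

section FixedPoint

lemma eventually_forall_mul_le_mul_rpow {p c δ : ℝ} (hp : 1 < p) (hc : 0 < c) (hδ : 0 < δ)
    (K : ℝ) : ∀ᶠ R : ℝ in 𝓝 0, ∀ w, δ ≤ w → K * R * w ≤ c * w ^ p := by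
  have h : ∀ᶠ R : ℝ in 𝓝 0, K * R < c * δ ^ (p - 1) := by
    have hc' : ContinuousAt (fun R : ℝ => K * R) 0 := by fun_prop
    apply hc'.eventually_lt_const
    simp only [mul_zero]; positivity
  filter_upwards [h] with R hR w hw
  have hw0 : 0 < w := by linarith
  have e : w ^ p = w ^ (p - 1) * w := by rw [← Real.rpow_add_one hw0.ne']; simp
  have h1 : δ ^ (p - 1) ≤ w ^ (p - 1) := Real.rpow_le_rpow hδ.le hw (by linarith)
  rw [e, ← mul_assoc]
  exact mul_le_mul_of_nonneg_right (hR.le.trans (mul_le_mul_of_nonneg_left h1 hc.le)) hw0.le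

/-- A power with exponent greater than one is negligible with respect to the identity at `0`. -/
lemma eventually_mul_rpow_le {p ε : ℝ} (hp : 1 < p) (hε : 0 < ε) (C : ℝ) :
    ∀ᶠ R : ℝ in 𝓝 0, 0 ≤ R → C * R ^ p ≤ ε * R := by
  have h : ∀ᶠ R : ℝ in 𝓝 0, C * R ^ (p - 1) < ε := by
    have hc' : ContinuousAt (fun R : ℝ => R ^ (p - 1)) 0 :=
      ContinuousAt.rpow_const continuousAt_id (Or.inr (by linarith))
    apply (hc'.const_mul C).eventually_lt_const
    simpa [Real.zero_rpow (by linarith : p - 1 ≠ 0)] using hε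
  filter_upwards [h] with R hR hR0
  rcases hR0.eq_or_lt with rfl | hR0
  · simp [Real.zero_rpow (by linarith : p ≠ 0)]
  have e : R ^ p = R ^ (p - 1) * R := by rw [← Real.rpow_add_one hR0.ne']; simp
  rw [e, ← mul_assoc]
  exact mul_le_mul_of_nonneg_right hR.le hR0.le

variable {V : Type*} [NormedAddCommGroup V]

lemma tendsto_norm_sub_nhds_zero (x₀ : V) : Tendsto (fun x => ‖x - x₀‖) (𝓝 x₀) (𝓝 0) := by
  have : Continuous fun x : V => ‖x - x₀‖ := by fun_prop
  simpa using this.tendsto x₀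

variable [InnerProductSpace ℝ V] [CompleteSpace V]

lemma exists_lipschitz_gradient {f : V → ℝ} {x₀ : V} (hf : ContDiffAt ℝ 2 f x₀) :
    ∃ K : ℝ, 0 ≤ K ∧ ∃ r : ℝ, 0 < r ∧ ∀ x ∈ Metric.ball x₀ r, ∀ y ∈ Metric.ball x₀ r,
      ‖∇ f x - ∇ f y‖ ≤ K * ‖x - y‖ := by
  obtain ⟨K, t, ht, hK⟩ := (hf.fderiv_right (m := 1) (by norm_num)).exists_lipschitzOnWith
  obtain ⟨r, hr, hrt⟩ := Metric.mem_nhds_iff.1 ht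
  refine ⟨K, K.2, r, hr, fun x hx y hy => ?_⟩
  have h := hK.dist_le_mul x (hrt hx) y (hrt hy)
  rw [dist_eq_norm, dist_eq_norm] at h
  rwa [gradient, gradient, ← map_sub, LinearIsometryEquiv.norm_map]

/-- The linearization is based at the moving point `x`. Its error is the differentiability error at
`x₀` plus a gradient-variation term that is quadratic in `‖x - x₀‖`. -/
lemma eventually_abs_linearization_sub_le {f : V → ℝ} {x₀ : V} {K r : ℝ} (hr : 0 < r)
    (hf : DifferentiableAt ℝ f x₀)
    (hK : ∀ x ∈ Metric.ball x₀ r, ∀ y ∈ Metric.ball x₀ r, ‖∇ f x - ∇ f y‖ ≤ K * ‖x - y‖)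
    {ε : ℝ} (hε : 0 < ε) :
    ∀ᶠ x in 𝓝 x₀, |f x + inner ℝ (∇ f x) (x₀ - x) - f x₀| ≤ ε * ‖x - x₀‖ := by
  have h2 : ∀ᶠ R : ℝ in 𝓝 0, K * R < ε / 2 := by
    have hc' : ContinuousAt (fun R : ℝ => K * R) 0 := by fun_prop
    apply hc'.eventually_lt_const
    simp only [mul_zero]; positivity
  filter_upwards [eventually_abs_sub_sub_inner_gradient_le hf (half_pos hε),
    Metric.ball_mem_nhds x₀ hr, (tendsto_norm_sub_nhds_zero x₀).eventually h2] with x h1 hx h2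
  have h3 : |inner ℝ (∇ f x - ∇ f x₀) (x - x₀)| ≤ ε / 2 * ‖x - x₀‖ :=
    (abs_real_inner_le_norm _ _).trans (mul_le_mul_of_nonneg_right
      ((hK x hx x₀ (Metric.mem_ball_self hr)).trans h2.le) (norm_nonneg _))
  have e : f x + inner ℝ (∇ f x) (x₀ - x) - f x₀ =
      (f x - f x₀ - inner ℝ (∇ f x₀) (x - x₀)) - inner ℝ (∇ f x - ∇ f x₀) (x - x₀) := by
    rw [inner_sub_left, ← neg_sub x x₀, inner_neg_right]; ring
  rw [e]
  exact (abs_sub _ _).trans (by linarith)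

lemma exists_lower_bound_of_mem_proxFixedPoints {f : V → ℝ} {g : V → EReal} {p γ : ℝ} {x₀ : V}
    (hp : 1 < p) (hg : IsProper g) (hx₀ : x₀ ∈ proxFixedPoints f g p γ) :
    ∃ g₀ : ℝ, g x₀ = g₀ ∧ ∀ y,
      ((g₀ - inner ℝ (∇ f x₀) (y - x₀) - 1 / (p * γ) * ‖x₀ - y‖ ^ p : ℝ) : EReal) ≤ g y := by
  obtain ⟨htop, hfix⟩ := hx₀
  induction h : g x₀ with
  | bot => exact absurd h (hg.1 x₀)
  | top =>
    rw [objective, h, EReal.coe_add_top] at htop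
    exact absurd rfl htop
  | coe g₀ =>
    refine ⟨g₀, rfl, fun y => ?_⟩
    have hy := hfix y
    rw [hifbModel_eq, hifbModel_eq, h] at hy
    induction hgy : g y with
    | bot => exact absurd hgy (hg.1 y)
    | top => exact le_top
    | coe r =>
      rw [hgy, ← EReal.coe_add, ← EReal.coe_add, EReal.coe_le_coe_iff] at hy
      simp only [sub_self, inner_zero_right, norm_zero,
        Real.zero_rpow (by linarith : p ≠ 0)] at hy
      rw [EReal.coe_le_coe_iff]
      linarith

/-- The model near a point at which `g` satisfies a lower bound of a lower order than the model
grows more than linearly in its second argument. -/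
lemma exists_model_lower_bound {f : V → ℝ} {g : V → EReal} {p γ b g₀ : ℝ} {x₀ : V}
    (hp : 1 < p) (hf : Differentiable ℝ f) (hf2 : ContDiffAt ℝ 2 f x₀)
    (hb : 0 ≤ b) (hbγ : b < 1 / (p * γ))
    (hbound : ∀ y, ((g₀ - inner ℝ (∇ f x₀) (y - x₀) - b * ‖x₀ - y‖ ^ p : ℝ) : EReal) ≤ g y) :
    ∃ c K : ℝ, 0 < c ∧ 0 ≤ K ∧ ∀ ε : ℝ, 0 < ε → ∀ᶠ x in 𝓝 x₀, ∀ y,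
      ((f x₀ + g₀ - ε * ‖x - x₀‖ - K * ‖x - x₀‖ * ‖y - x₀‖ + c * ‖y - x₀‖ ^ p : ℝ) : EReal) ≤
        hifbModel f g p γ x y := by
  obtain ⟨K, hK0, r, hr, hK⟩ := exists_lipschitz_gradient hf2
  -- The gap `b' - b` survives as the growth constant; the gap from `b'` to `1 / (p * γ)` pays for
  -- recentring the power from `x` to `x₀`.
  obtain ⟨b', hbb', hb'⟩ := exists_between hbγ
  obtain ⟨C, hC0, hC⟩ := exists_mul_add_rpow_le hp (hb.trans hbb'.le) hb'
  refine ⟨b' - b, K, by linarith, hK0, fun ε hε => ?_⟩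
  filter_upwards [eventually_abs_linearization_sub_le hr (hf x₀) hK (half_pos hε),
    Metric.ball_mem_nhds x₀ hr, (tendsto_norm_sub_nhds_zero x₀).eventually
    (eventually_mul_rpow_le hp (half_pos hε) C)] with x h1 hx h2 y
  rw [hifbModel_eq]
  refine le_trans ?_ (add_le_add le_rfl (hbound y))
  rw [← EReal.coe_add, EReal.coe_le_coe_iff]
  have h1 := neg_le_of_abs_le h1
  have h2 := h2 (norm_nonneg _)
  have h3 : -(K * ‖x - x₀‖ * ‖y - x₀‖) ≤ inner ℝ (∇ f x - ∇ f x₀) (y - x₀) :=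
    neg_le_of_abs_le ((abs_real_inner_le_norm _ _).trans
      (mul_le_mul_of_nonneg_right (hK x hx x₀ (Metric.mem_ball_self hr)) (norm_nonneg _)))
  rw [inner_sub_left] at h3
  have e : inner ℝ (∇ f x) (y - x) = inner ℝ (∇ f x) (y - x₀) + inner ℝ (∇ f x) (x₀ - x) := by
    rw [← inner_add_right]; congr 1; abel
  have h4 : ‖y - x₀‖ ≤ ‖x - y‖ + ‖x - x₀‖ := by
    rw [show y - x₀ = (x - x₀) - (x - y) by abel]
    exact (norm_sub_le _ _).trans (by linarith)
  have h5 : b' * ‖y - x₀‖ ^ p ≤ b' * (‖x - y‖ + ‖x - x₀‖) ^ p :=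
    mul_le_mul_of_nonneg_left (Real.rpow_le_rpow (norm_nonneg _) h4 (by linarith))
      (hb.trans hbb'.le)
  have h6 := hC _ _ (norm_nonneg (x - y)) (norm_nonneg (x - x₀))
  rw [norm_sub_rev x₀ y, e]
  linarith

variable {f : V → ℝ} {g : V → EReal} {p γ b g₀ : ℝ} {x₀ : V}

lemma hifbModel_self (hp : 1 < p) (hg₀ : g x₀ = g₀) :
    hifbModel f g p γ x₀ x₀ = ((f x₀ + g₀ : ℝ) : EReal) := by
  rw [hifbModel_eq, hg₀, ← EReal.coe_add]
  simp [Real.zero_rpow (by linarith : p ≠ 0)]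

lemma mem_hifbs_self (hp : 1 < p) (hg₀ : g x₀ = g₀) (hbγ : b < 1 / (p * γ))
    (hbound : ∀ y, ((g₀ - inner ℝ (∇ f x₀) (y - x₀) - b * ‖x₀ - y‖ ^ p : ℝ) : EReal) ≤ g y) :
    x₀ ∈ hifbs f g p γ x₀ := by
  intro y
  rw [hifbModel_self hp hg₀, hifbModel_eq]
  refine le_trans ?_ (add_le_add le_rfl (hbound y))
  rw [← EReal.coe_add, EReal.coe_le_coe_iff]
  have := mul_le_mul_of_nonneg_right hbγ.le (Real.rpow_nonneg (norm_nonneg (x₀ - y)) p)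
  linarith

/-- Only the cross term `K * ‖x - x₀‖ * ‖y - x₀‖` could spoil the bound. For `y` far from `x₀` the
power growth absorbs it; for `y` close it is at most `ε / 2 * ‖x - x₀‖`. -/
lemma zero_mem_frechetSubdifferential_hifbe (hp : 1 < p) (hf : Differentiable ℝ f)
    (hf2 : ContDiffAt ℝ 2 f x₀) (hg₀ : g x₀ = g₀) (hb : 0 ≤ b) (hbγ : b < 1 / (p * γ))
    (hbound : ∀ y, ((g₀ - inner ℝ (∇ f x₀) (y - x₀) - b * ‖x₀ - y‖ ^ p : ℝ) : EReal) ≤ g y) :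
    0 ∈ frechetSubdifferential (hifbe f g p γ) x₀ := by
  obtain ⟨c, K, hc, hK, h⟩ := exists_model_lower_bound hp hf hf2 hb hbγ hbound
  have he : hifbe f g p γ x₀ = ((f x₀ + g₀ : ℝ) : EReal) := by
    rw [hifbe_eq_of_mem_hifbs (mem_hifbs_self hp hg₀ hbγ hbound), hifbModel_self hp hg₀]
  refine ⟨he ▸ EReal.coe_ne_top _, he ▸ EReal.coe_ne_bot _, fun ε hε => ?_⟩
  have hδ : 0 < ε / (2 * (K + 1)) := by positivity
  filter_upwards [h _ (half_pos hε), (tendsto_norm_sub_nhds_zero x₀).eventually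
    (eventually_forall_mul_le_mul_rpow hp hc hδ K)] with x h1 h2
  rw [he, inner_zero_left, ← EReal.coe_add]
  refine le_iInf fun y => le_trans ?_ (h1 y)
  rw [EReal.coe_le_coe_iff]
  have h3 : 0 ≤ c * ‖y - x₀‖ ^ p := by positivity
  rcases le_total (ε / (2 * (K + 1))) ‖y - x₀‖ with h4 | h4
  · have := h2 _ h4
    have := mul_nonneg hε.le (norm_nonneg (x - x₀))
    linarith
  · have h5 : K * ‖y - x₀‖ ≤ ε / 2 := by
      calc K * ‖y - x₀‖ ≤ (K + 1) * (ε / (2 * (K + 1))) := by gcongr; linarith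
        _ = ε / 2 := by field_simp
    have := mul_le_mul_of_nonneg_right h5 (norm_nonneg (x - x₀))
    linarith

/-- Forward-backward steps from points near a fixed point stay near the fixed point. -/
lemma eventually_forall_mem_hifbs_norm_sub_lt (hp : 1 < p) (hf : Differentiable ℝ f)
    (hf2 : ContDiffAt ℝ 2 f x₀) (hg₀ : g x₀ = g₀) (hb : 0 ≤ b) (hbγ : b < 1 / (p * γ))
    (hbound : ∀ y, ((g₀ - inner ℝ (∇ f x₀) (y - x₀) - b * ‖x₀ - y‖ ^ p : ℝ) : EReal) ≤ g y)
    {δ : ℝ} (hδ : 0 < δ) : ∀ᶠ x in 𝓝 x₀, ∀ y ∈ hifbs f g p γ x, ‖y - x₀‖ < δ := by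
  obtain ⟨c, K, hc, hK, h⟩ := exists_model_lower_bound hp hf hf2 hb hbγ hbound
  obtain ⟨K', -, r, hr, hK'⟩ := exists_lipschitz_gradient hf2
  -- Comparing `y` with the competitor `x₀` costs `R = ‖x - x₀‖` three times: in the model lower
  -- bound, the linearization error and the proximal power.
  have h0 : ∀ᶠ R : ℝ in 𝓝 0, 3 * R < c / 2 * δ ^ p := by
    have hc' : ContinuousAt (fun R : ℝ => 3 * R) 0 := by fun_prop
    apply hc'.eventually_lt_const
    simp only [mul_zero]; positivity
  filter_upwards [h 1 one_pos, eventually_abs_linearization_sub_le hr (hf x₀) hK' one_pos,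
    (tendsto_norm_sub_nhds_zero x₀).eventually
      (eventually_forall_mul_le_mul_rpow hp (half_pos hc) hδ K),
    (tendsto_norm_sub_nhds_zero x₀).eventually
      (eventually_mul_rpow_le hp one_pos (1 / (p * γ))),
    (tendsto_norm_sub_nhds_zero x₀).eventually h0] with x h1 h2 h3 h4 h5 y hy
  by_contra! hcon
  have h6 := (h1 y).trans (hy x₀)
  rw [hifbModel_eq, hg₀, ← EReal.coe_add, EReal.coe_le_coe_iff] at h6
  have h2 := le_of_abs_le h2
  have h3 := h3 _ hcon
  have h4 := h4 (norm_nonneg _)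
  have h7 : c / 2 * δ ^ p ≤ c / 2 * ‖y - x₀‖ ^ p :=
    mul_le_mul_of_nonneg_left (Real.rpow_le_rpow hδ.le hcon (by linarith)) (by linarith)
  linarith

end FixedPoint

/-! ### Subgradients of the envelope: transfer to `ell` and control of the step length. -/

section Calculus

variable {V : Type*} [NormedAddCommGroup V]

lemma norm_toLp_le (u v : V) : ‖(WithLp.toLp 2 (u, v) : WithLp 2 (V × V))‖ ≤ ‖u‖ + ‖v‖ := by
  rw [WithLp.prod_norm_eq_of_L2]
  apply Real.sqrt_le_iff.2
  refine ⟨by positivity, ?_⟩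
  change ‖u‖ ^ 2 + ‖v‖ ^ 2 ≤ _
  nlinarith [mul_nonneg (norm_nonneg u) (norm_nonneg v)]

lemma rpow_sub_two_mul_norm {p : ℝ} (hp : 1 < p) (d : V) :
    ‖d‖ ^ (p - 2) * ‖d‖ = ‖d‖ ^ (p - 1) := by
  rcases (norm_nonneg d).eq_or_lt with h | h
  · rw [← h, mul_zero, Real.zero_rpow (by linarith)]
  · rw [← Real.rpow_add_one h.ne']; congr 1; ring

variable [InnerProductSpace ℝ V]

lemma norm_toLp_sub_toLp_le {p γ : ℝ} (hp : 1 < p) (hγ : 0 < γ) (x y v : V) :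
    ‖(WithLp.toLp 2 (v, 0) - WithLp.toLp 2 ((1 / γ * ‖x - y‖ ^ (p - 2)) • (x - y),
        -((1 / γ * ‖x - y‖ ^ (p - 2)) • (x - y))) : WithLp 2 (V × V))‖ ≤
      ‖v‖ + 2 / γ * ‖x - y‖ ^ (p - 1) := by
  refine (norm_sub_le _ _).trans ((add_le_add (norm_toLp_le _ _) (norm_toLp_le _ _)).trans ?_)
  rw [norm_zero, norm_neg, norm_smul, Real.norm_of_nonneg (by positivity), mul_assoc,
    rpow_sub_two_mul_norm hp]
  apply le_of_eq; ring

/-- Removing a differentiable summand from a function with a Fréchet subgradient. -/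
lemma sub_mem_frechetSubdifferential {h : V → EReal} {N : V → ℝ} {z ζ w : V} {N' : V →L[ℝ] ℝ}
    (hζ : ζ ∈ frechetSubdifferential (fun u => h u + (N u : EReal)) z)
    (hN : HasFDerivAt N N' z) (hw : ∀ u, N' u = inner ℝ w u) :
    ζ - w ∈ frechetSubdifferential h z := by
  obtain ⟨h1, h2, h3⟩ := hζ
  simp only at h1 h2 h3
  have htop : h z ≠ ⊤ := fun hz => h1 (by rw [hz, EReal.top_add_coe])
  have hbot : h z ≠ ⊥ := fun hz => h2 (by rw [hz, EReal.bot_add])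
  refine ⟨htop, hbot, fun ε hε => ?_⟩
  filter_upwards [h3 _ (half_pos hε), hN.isLittleO.bound (half_pos hε)] with y hy1 hy2
  rw [Real.norm_eq_abs, hw] at hy2
  have hy2 := le_of_abs_le hy2
  lift h z to ℝ using ⟨htop, hbot⟩ with a
  rw [← EReal.coe_add] at hy1 ⊢
  rw [← EReal.coe_add] at hy1
  induction hy : h y with
  | bot =>
    rw [hy, EReal.bot_add] at hy1
    exact absurd (le_bot_iff.1 hy1) (EReal.coe_ne_bot _)
  | top => exact le_top
  | coe r =>
    rw [hy, ← EReal.coe_add, EReal.coe_le_coe_iff] at hy1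
    rw [EReal.coe_le_coe_iff, inner_sub_left]
    linarith

lemma frechetSubdifferential_subset_of_le {h k : V → EReal} {x : V} (hle : ∀ y, h y ≤ k y)
    (heq : h x = k x) : frechetSubdifferential h x ⊆ frechetSubdifferential k x := by
  rintro ζ ⟨h1, h2, h3⟩
  refine ⟨heq ▸ h1, heq ▸ h2, fun ε hε => ?_⟩
  filter_upwards [h3 ε hε] with y hy
  exact heq ▸ hy.trans (hle y)

variable [CompleteSpace V] {f : V → ℝ} {g : V → EReal} {p γ : ℝ} {x y v : V}

/-- The envelope, read as a function of the pair that ignores the second variable, touches the model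
from below at `(x, y)`. -/
lemma toLp_zero_mem_frechetSubdifferential_model
    (hv : v ∈ frechetSubdifferential (hifbe f g p γ) x) (hy : y ∈ hifbs f g p γ x) :
    (WithLp.toLp 2 (v, 0) : WithLp 2 (V × V)) ∈ frechetSubdifferential
      (fun z : WithLp 2 (V × V) => hifbModel f g p γ z.fst z.snd) (WithLp.toLp 2 (x, y)) := by
  have hxy := hifbe_eq_of_mem_hifbs hy
  obtain ⟨h1, h2, h3⟩ := hv
  rw [hxy] at h1 h2
  refine ⟨h1, h2, fun ε hε => ?_⟩
  have ht : Tendsto (fun z : WithLp 2 (V × V) => z.fst) (𝓝 (WithLp.toLp 2 (x, y))) (𝓝 x) :=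
    (WithLp.fstL 2 ℝ V V).continuous.tendsto (WithLp.toLp 2 (x, y))
  filter_upwards [ht.eventually (h3 ε hε)] with z hz
  refine le_trans ?_ (hz.trans (hifbe_le_hifbModel f g p γ z.fst z.snd))
  rw [hxy]
  refine add_le_add le_rfl ?_
  rw [EReal.coe_le_coe_iff, WithLp.prod_inner_apply]
  have : ‖z.fst - x‖ ≤ ‖z - WithLp.toLp 2 (x, y)‖ := by
    rw [WithLp.prod_norm_eq_of_L2]
    apply Real.le_sqrt_of_sq_le
    change ‖z.fst - x‖ ^ 2 ≤ ‖z.fst - x‖ ^ 2 + _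
    have := sq_nonneg ‖(z - WithLp.toLp 2 (x, y)).snd‖
    linarith
  have h4 := mul_le_mul_of_nonneg_left this hε.le
  have e : inner ℝ v (z - WithLp.toLp 2 (x, y)).ofLp.1 = inner ℝ v (z.fst - x) := rfl
  simp only [e, inner_zero_left]
  linarith

/-- Fréchet subgradients of the envelope give Fréchet subgradients of `ell`. -/
lemma toLp_mem_frechetSubdifferential_ell (hp : 1 < p) (hγ : 0 < γ)
    (hv : v ∈ frechetSubdifferential (hifbe f g p γ) x) (hy : y ∈ hifbs f g p γ x) :
    (WithLp.toLp 2 (v, 0) - WithLp.toLp 2 ((1 / γ * ‖x - y‖ ^ (p - 2)) • (x - y),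
        -((1 / γ * ‖x - y‖ ^ (p - 2)) • (x - y))) : WithLp 2 (V × V)) ∈
      frechetSubdifferential (ell f g) (WithLp.toLp 2 (x, y)) := by
  have hD := ((hasFDerivAt_norm_rpow (x - y) hp).comp
    (WithLp.toLp 2 (x, y) : WithLp 2 (V × V))
    (WithLp.fstL 2 ℝ V V - WithLp.sndL 2 ℝ V V).hasFDerivAt).const_mul (1 / (p * γ))
  refine sub_mem_frechetSubdifferential (toLp_zero_mem_frechetSubdifferential_model hv hy) hD
    fun u => ?_
  have hp0 : p ≠ 0 := by linarith
  rw [WithLp.prod_inner_apply]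
  simp only [smul_apply, ContinuousLinearMap.comp_apply,
    sub_apply, innerSL_apply_apply, smul_eq_mul, inner_neg_left,
    real_inner_smul_left, WithLp.fstL_apply, WithLp.sndL_apply]
  rw [inner_sub_right]
  change _ = 1 / γ * ‖x - y‖ ^ (p - 2) * inner ℝ (x - y) u.fst +
    -(1 / γ * ‖x - y‖ ^ (p - 2) * inner ℝ (x - y) u.snd)
  field_simp
  ring

lemma exists_coe_of_mem_hifbs (hg : IsProper g) (hy : y ∈ hifbs f g p γ x) :
    ∃ r : ℝ, g y = r := by
  have h := hifbe_ne_top (f := f) hg p γ x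
  rw [hifbe_eq_of_mem_hifbs hy, hifbModel_eq] at h
  induction hgy : g y with
  | bot => exact absurd hgy (hg.1 y)
  | top => rw [hgy, EReal.coe_add_top] at h; exact absurd rfl h
  | coe r => exact ⟨r, rfl⟩

/-- A lower bound on the derivative of the envelope in the direction of the step. -/
lemma le_inner_of_mem_frechetSubdifferential_hifbe {L B : ℝ} (hp : 1 < p) (hγ : 0 < γ)
    (hg : IsProper g) (hmaj : ∀ x y, f y ≤ f x + inner ℝ (∇ f x) (y - x) + L / p * ‖y - x‖ ^ p)
    (hB0 : 0 ≤ B)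
    (hB : ∀ t : ℝ, 0 < t → t < 1 →
      inner ℝ (∇ f x - ∇ f (x - t • (x - y))) (x - y) ≤ t * B)
    (hv : v ∈ frechetSubdifferential (hifbe f g p γ) x) (hy : y ∈ hifbs f g p γ x) :
    1 / γ * ‖x - y‖ ^ p - B ≤ inner ℝ v (x - y) := by
  obtain ⟨G, hG⟩ := exists_coe_of_mem_hifbs hg hy
  obtain ⟨-, -, h3⟩ := hv
  rw [hifbe_eq_of_mem_hifbs hy, hifbModel_eq, hG, ← EReal.coe_add] at h3
  generalize hd : x - y = d at *
  set D := ‖d‖ ^ p with hD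
  set a := 1 / (p * γ) with ha
  have hp0 : p ≠ 0 := by linarith
  have hap : a * p = 1 / γ := by rw [ha]; field_simp
  -- These are the `p`-th power terms along `x - t • d`. The majorant error has zero derivative at
  -- `0` because `p > 1`, so only the proximal decrease contributes.
  have hderiv : HasDerivAt (fun t : ℝ => L / p * t ^ p * D + a * D * (1 - t) ^ p)
      (-(a * p * D)) 0 := by
    have h1 : HasDerivAt (fun t : ℝ => t ^ p) (p * (0 : ℝ) ^ (p - 1)) 0 :=
      Real.hasDerivAt_rpow_const (Or.inr hp.le)
    have h2 : HasDerivAt (fun t : ℝ => (1 - t) ^ p) (-1 * p * (1 - 0 : ℝ) ^ (p - 1)) 0 :=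
      ((hasDerivAt_id (0 : ℝ)).const_sub 1).rpow_const (Or.inr hp.le)
    refine (((h1.const_mul (L / p)).mul_const D).add (h2.const_mul (a * D))).congr_deriv ?_
    rw [Real.zero_rpow (by linarith : p - 1 ≠ 0), sub_zero, Real.one_rpow]; ring
  have hslope := hderiv.tendsto_slope_zero_right
  have hx' : Tendsto (fun t : ℝ => x - t • d) (𝓝[>] 0) (𝓝 x) := by
    have : Continuous fun t : ℝ => x - t • d := by fun_prop
    have := this.tendsto 0
    simp only [zero_smul, sub_zero] at this
    exact this.mono_left nhdsWithin_le_nhds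
  refine le_of_forall_pos_le_add fun e he => ?_
  have hε : 0 < e / (‖d‖ + 1) := by positivity
  have hεd : e / (‖d‖ + 1) * ‖d‖ ≤ e := by
    rw [div_mul_eq_mul_div, div_le_iff₀ (by positivity)]; nlinarith [norm_nonneg d]
  -- The subgradient inequality at `x - t • d` is chained with the model at the unchanged `y` and
  -- the majorant of `f`; the gradient terms combine into `(1 - t)` times the quantity bounded by `t
  -- * B`.
  have hkey : ∀ᶠ t : ℝ in 𝓝[>] 0, -inner ℝ v d - B - e ≤
      t⁻¹ • ((fun t : ℝ => L / p * t ^ p * D + a * D * (1 - t) ^ p) (0 + t) -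
        (fun t : ℝ => L / p * t ^ p * D + a * D * (1 - t) ^ p) 0) := by
    filter_upwards [hx'.eventually (h3 _ hε), self_mem_nhdsWithin,
      Ioo_mem_nhdsGT (show (0 : ℝ) < 1 by norm_num)] with t ht _ ht01
    obtain ⟨ht0, ht1⟩ := ht01
    have h4 := ht.trans (hifbe_le_hifbModel f g p γ _ y)
    rw [hifbModel_eq, hG, ← EReal.coe_add, ← EReal.coe_add, EReal.coe_le_coe_iff] at h4
    have e1 : x - t • d - x = -(t • d) := by abel
    have e2 : x - t • d - y = (1 - t) • d := by rw [sub_smul, one_smul, ← hd]; abel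
    have e3 : y - (x - t • d) = -((1 - t) • d) := by rw [← e2]; abel
    have e4 : y - x = -d := by rw [← hd]; abel
    have h5 := hmaj x (x - t • d)
    have h6 := hB t ht0 ht1
    rw [e1, norm_neg, norm_smul, Real.norm_of_nonneg ht0.le, inner_neg_right,
      real_inner_smul_right, Real.mul_rpow ht0.le (norm_nonneg _)] at h5
    rw [e1, e2, e3, e4, norm_neg, norm_smul, norm_smul, Real.norm_of_nonneg ht0.le,
      Real.norm_of_nonneg (by linarith), inner_neg_right, inner_neg_right, inner_neg_right,
      real_inner_smul_right, real_inner_smul_right,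
      Real.mul_rpow (by linarith) (norm_nonneg _)] at h4
    rw [inner_sub_left] at h6
    rw [← hD] at h4 h5
    simp only [zero_add, smul_eq_mul, sub_zero, Real.one_rpow, Real.zero_rpow hp0, mul_zero,
      zero_mul, mul_one]
    rw [inv_mul_eq_div, le_div_iff₀ ht0]
    have h7 : (1 - t) * (inner ℝ (∇ f x) d - inner ℝ (∇ f (x - t • d)) d) ≤ t * B := by
      have h8 := mul_le_mul_of_nonneg_left h6 (show 0 ≤ 1 - t by linarith)
      have h9 := mul_nonneg ht0.le (mul_nonneg ht0.le hB0)
      linarith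
    have h10 := mul_le_mul_of_nonneg_left hεd ht0.le
    linarith
  have := ge_of_tendsto hslope hkey
  rw [hap] at this
  linarith

/-- Subgradients of the envelope control the length of the forward-backward step. -/
lemma exists_mul_rpow_le_norm_subgradient {L : ℝ} {x₀ : V} (hp : 1 < p) (hγ : 0 < γ)
    (hL : 0 < L) (hγL : γ < L⁻¹) (hg : IsProper g)
    (hmaj : ∀ x y, f y ≤ f x + inner ℝ (∇ f x) (y - x) + L / p * ‖y - x‖ ^ p)
    (hf2 : ContDiffAt ℝ 2 f x₀) :
    ∃ κ : ℝ, 0 < κ ∧ ∃ r : ℝ, 0 < r ∧ ∀ x ∈ Metric.ball x₀ r, ∀ y ∈ Metric.ball x₀ r, ∀ v,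
      v ∈ frechetSubdifferential (hifbe f g p γ) x → y ∈ hifbs f g p γ x →
        κ * ‖x - y‖ ^ (p - 1) ≤ ‖v‖ := by
  have hLγ : L < 1 / γ := by
    rw [lt_one_div hL hγ, one_div]; exact hγL
  -- With `B = β * ‖x - y‖ ^ p` the directional bound gives `κ = 1 / γ - β`.
  suffices H : ∃ β : ℝ, 0 ≤ β ∧ β < 1 / γ ∧ ∃ r : ℝ, 0 < r ∧ ∀ x ∈ Metric.ball x₀ r,
      ∀ y ∈ Metric.ball x₀ r, ∀ t : ℝ, 0 < t → t < 1 →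
        inner ℝ (∇ f x - ∇ f (x - t • (x - y))) (x - y) ≤ t * (β * ‖x - y‖ ^ p) by
    obtain ⟨β, hβ0, hβ, r, hr, H⟩ := H
    refine ⟨1 / γ - β, by linarith, r, hr, fun x hx y hy v hv hxy => ?_⟩
    have h1 := le_inner_of_mem_frechetSubdifferential_hifbe hp hγ hg hmaj (by positivity)
      (H x hx y hy) hv hxy
    have h2 := h1.trans (real_inner_le_norm v (x - y))
    rcases (norm_nonneg (x - y)).eq_or_lt with h | h
    · rw [← h, Real.zero_rpow (by linarith), mul_zero]; exact norm_nonneg _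
    · have e : ‖x - y‖ ^ p = ‖x - y‖ ^ (p - 1) * ‖x - y‖ := by
        rw [← Real.rpow_add_one h.ne']; simp
      rw [e] at h2
      refine le_of_mul_le_mul_right ?_ h
      linarith
  -- For `p ≥ 2`, adding the majorants at both endpoints gives `β = L`, from `2 / p ≤ 1` and `t ^ p
  -- ≤ t ^ 2`. For `p < 2` that fails for small `t`; instead the local Lipschitz bound `K ‖d‖ ^ 2 =
  -- K ‖d‖ ^ (2 - p) ‖d‖ ^ p` has a small coefficient near `x₀`.
  rcases le_or_gt 2 p with hp2 | hp2
  · refine ⟨L, hL.le, hLγ, 1, one_pos, fun x _ y _ t ht0 ht1 => ?_⟩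
    generalize x - y = d
    have h1 := hmaj x (x - t • d)
    have h2 := hmaj (x - t • d) x
    have e1 : x - t • d - x = -(t • d) := by abel
    have e2 : x - (x - t • d) = t • d := by abel
    rw [e1, norm_neg, norm_smul, Real.norm_of_nonneg ht0.le, inner_neg_right,
      real_inner_smul_right, Real.mul_rpow ht0.le (norm_nonneg _)] at h1
    rw [e2, norm_smul, Real.norm_of_nonneg ht0.le,
      real_inner_smul_right, Real.mul_rpow ht0.le (norm_nonneg _)] at h2
    have h3 : t ^ p ≤ t * t := by
      calc t ^ p ≤ t ^ (2 : ℝ) := Real.rpow_le_rpow_of_exponent_ge ht0 ht1.le hp2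
        _ = t * t := by rw [Real.rpow_two, sq]
    have h4 : 2 * (L / p) ≤ L := by
      rw [← mul_div_assoc, div_le_iff₀ (by linarith)]; nlinarith
    have hD : 0 ≤ ‖d‖ ^ p := by positivity
    have h5 : 2 * (L / p) * (t ^ p * ‖d‖ ^ p) ≤ L * (t * t * ‖d‖ ^ p) :=
      mul_le_mul h4 (mul_le_mul_of_nonneg_right h3 hD) (by positivity) hL.le
    rw [inner_sub_left]
    refine le_of_mul_le_mul_left ?_ ht0
    linarith
  · obtain ⟨K, hK0, r, hr, hK⟩ := exists_lipschitz_gradient hf2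
    have hsmall : ∀ᶠ s : ℝ in 𝓝 0, K * s ^ (2 - p) < 1 / (2 * γ) := by
      have hc' : ContinuousAt (fun s : ℝ => s ^ (2 - p)) 0 :=
        ContinuousAt.rpow_const continuousAt_id (Or.inr (by linarith))
      apply (hc'.const_mul K).eventually_lt_const
      beta_reduce
      rw [Real.zero_rpow (by linarith : 2 - p ≠ 0), mul_zero]; positivity
    obtain ⟨δ, hδ, hsmall⟩ := Metric.eventually_nhds_iff.1 hsmall
    refine ⟨1 / (2 * γ), by positivity, ?_, min r (δ / 2), lt_min hr (half_pos hδ),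
      fun x hx y hy t ht0 ht1 => ?_⟩
    · apply one_div_lt_one_div_of_lt hγ; linarith
    have hxr := Metric.ball_subset_ball (min_le_left r (δ / 2)) hx
    have hyr := Metric.ball_subset_ball (min_le_left r (δ / 2)) hy
    have hx' : x - t • (x - y) ∈ Metric.ball x₀ r := by
      have e : x - t • (x - y) = (1 - t) • x + t • y := by
        rw [smul_sub, sub_smul, one_smul]; abel
      rw [e]
      exact convex_ball x₀ r hxr hyr (by linarith) ht0.le (by ring)
    have hd : ‖x - y‖ < δ := by
      rw [← dist_eq_norm]
      have h1 := Metric.mem_ball.1 (Metric.ball_subset_ball (min_le_right r (δ / 2)) hx)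
      have h2 := Metric.mem_ball.1 (Metric.ball_subset_ball (min_le_right r (δ / 2)) hy)
      linarith [dist_triangle_right x y x₀]
    have h1 := hK x hxr _ hx'
    rw [sub_sub_cancel, norm_smul, Real.norm_of_nonneg ht0.le] at h1
    have h2 := (real_inner_le_norm (∇ f x - ∇ f (x - t • (x - y))) (x - y)).trans
      (mul_le_mul_of_nonneg_right h1 (norm_nonneg _))
    refine h2.trans ?_
    rcases (norm_nonneg (x - y)).eq_or_lt with h | h
    · rw [← h, Real.zero_rpow (by linarith)]; simp
    have h3 := (hsmall (show dist ‖x - y‖ 0 < δ by simpa using hd)).le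
    have e : ‖x - y‖ * ‖x - y‖ = ‖x - y‖ ^ (2 - p) * ‖x - y‖ ^ p := by
      rw [← Real.rpow_add h, ← sq, ← Real.rpow_two]; congr 1; ring
    have h4 := mul_le_mul_of_nonneg_right h3 (show 0 ≤ t * ‖x - y‖ ^ p by positivity)
    calc K * (t * ‖x - y‖) * ‖x - y‖ = K * t * (‖x - y‖ * ‖x - y‖) := by ring
      _ = K * ‖x - y‖ ^ (2 - p) * (t * ‖x - y‖ ^ p) := by rw [e]; ring
      _ ≤ _ := by linarith

end Calculus

/-! ### Quotient-free form of the KL inequality. -/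

section KL

variable {V : Type*} [NormedAddCommGroup V] [InnerProductSpace ℝ V] {h : V → EReal} {x₀ : V}
  {θ : ℝ}

lemma deriv_const_mul_rpow_one_sub {c θ t : ℝ} (ht : 0 < t) :
    deriv (fun t : ℝ => c * t ^ (1 - θ)) t = c * (1 - θ) * (t ^ θ)⁻¹ := by
  have := (Real.hasDerivAt_rpow_const (x := t) (p := 1 - θ) (Or.inl ht.ne')).const_mul c
  rw [this.deriv, show 1 - θ - 1 = -θ by ring, Real.rpow_neg ht.le]
  ring

/-- Clearing the derivative of the desingularizing function removes the need for a nonzero gap: at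
equal values the left side is `0` because `θ > 0`. -/
lemma KLExponentAt.exists_rpow_le (hKL : KLExponentAt h x₀ θ) (hθ : 0 < θ) :
    ∃ r : ℝ, 0 < r ∧ ∃ η : ℝ, 0 < η ∧ ∃ C : ℝ, 0 < C ∧ ∀ x ∈ Metric.ball x₀ r,
      ∀ ζ ∈ frechetSubdifferential h x, |(h x).toReal - (h x₀).toReal| < η →
        |(h x).toReal - (h x₀).toReal| ^ θ ≤ C * ‖ζ‖ := by
  obtain ⟨-, -, -, -, hθ1, c, hc, r, hr, η, hη, H⟩ := hKL
  obtain ⟨η', hη'0, hη'⟩ := EReal.lt_iff_exists_real_btwn.1 hη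
  rw [← EReal.coe_zero, EReal.coe_lt_coe_iff] at hη'0
  have hC : 0 < c * (1 - θ) := mul_pos hc (by linarith)
  refine ⟨r, hr, η', hη'0, c * (1 - θ), hC, fun x hx ζ hζ hlt => ?_⟩
  have hζ' := frechetSubdifferential_subset_limitingSubdifferential h x hζ
  rcases (abs_nonneg ((h x).toReal - (h x₀).toReal)).eq_or_lt with h0 | h0
  · rw [← h0, Real.zero_rpow hθ.ne']; positivity
  have h1 := H x hx ⟨ζ, hζ'⟩ h0 (lt_trans (EReal.coe_lt_coe_iff.2 hlt) hη')
  rw [deriv_const_mul_rpow_one_sub h0] at h1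
  have h2 := Metric.infDist_le_dist_of_mem (x := 0) hζ'
  rw [dist_zero_left] at h2
  have h3 : 0 < |(h x).toReal - (h x₀).toReal| ^ θ := Real.rpow_pos_of_pos h0 θ
  generalize |(h x).toReal - (h x₀).toReal| ^ θ = s at *
  rw [mul_right_comm, ← div_eq_mul_inv, le_div_iff₀ h3, one_mul] at h1
  exact h1.trans (mul_le_mul_of_nonneg_left h2 hC.le)

/-- Fréchet subgradients suffice: a limiting subgradient is approached along points whose values
converge, the ball and the value bound are open conditions, and both sides pass to the limit. -/
lemma exists_klInequality_of_rpow_le (hθ : 0 < θ) (hθ1 : θ < 1) {r η C : ℝ} (hr : 0 < r)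
    (hη : 0 < η) (hC : 0 < C)
    (H : ∀ x ∈ Metric.ball x₀ r, ∀ ζ ∈ frechetSubdifferential h x,
      |(h x).toReal - (h x₀).toReal| < η → |(h x).toReal - (h x₀).toReal| ^ θ ≤ C * ‖ζ‖) :
    ∃ c : ℝ, 0 < c ∧ KLInequality h x₀ (fun t => c * t ^ (1 - θ)) := by
  have hθ' : 0 < 1 - θ := by linarith
  refine ⟨C / (1 - θ), by positivity, r, hr, η, by exact_mod_cast hη, fun x hx hdom h0 hlt => ?_⟩
  rw [EReal.coe_lt_coe_iff] at hlt
  rw [deriv_const_mul_rpow_one_sub h0, div_mul_cancel₀ _ hθ'.ne']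
  have h3 : 0 < |(h x).toReal - (h x₀).toReal| ^ θ := Real.rpow_pos_of_pos h0 θ
  have key : |(h x).toReal - (h x₀).toReal| ^ θ / C ≤
      Metric.infDist 0 (limitingSubdifferential h x) := by
    refine (Metric.le_infDist hdom).2 fun ζ hζ => ?_
    obtain ⟨h1, h2, u, v, hu, hv, hhu, hvζ⟩ := hζ
    have ht := (((EReal.tendsto_toReal h1 h2).comp hhu).sub_const (h x₀).toReal).abs
    have ht' : Tendsto (fun k => |(h (u k)).toReal - (h x₀).toReal| ^ θ) atTop
        (𝓝 (|(h x).toReal - (h x₀).toReal| ^ θ)) := ht.rpow_const (Or.inr hθ.le)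
    rw [dist_zero_left, div_le_iff₀ hC, mul_comm]
    refine le_of_tendsto_of_tendsto ht' (hvζ.norm.const_mul C) ?_
    filter_upwards [ht.eventually_lt_const hlt, hu.eventually (Metric.isOpen_ball.mem_nhds hx)]
      with k hk1 hk2
    exact H _ hk2 _ (hv k) hk1
  rw [div_le_iff₀ hC] at key
  rw [mul_right_comm, ← div_eq_mul_inv, le_div_iff₀ h3, one_mul]
  linarith

end KL

/-! ### Assembly: the exponent of `ell` passes to the envelope. -/

variable {V : Type*} [NormedAddCommGroup V] [InnerProductSpace ℝ V] [CompleteSpace V]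

/-- The Łojasiewicz inequality for the envelope, at Fréchet subgradients, from the one for `ell`. -/
lemma exists_rpow_le_of_klExponentAt_ell [ProperSpace V] {f : V → ℝ} {g : V → EReal}
    {p L γ θ b g₀ : ℝ} {x₀ : V} (hf : Differentiable ℝ f) (hfmaj : HasHighOrderMajorant f p L)
    (hg : IsProper g) (hglsc : LowerSemicontinuous g) (hθ : (p - 1) / p ≤ θ)
    (hKL : KLExponentAt (ell f g) (WithLp.toLp 2 (x₀, x₀)) θ) (hf2 : ContDiffAt ℝ 2 f x₀)
    (hγ : 0 < γ) (hγL : γ < L⁻¹) (hlt : (γ : EReal) < proxThreshold g p)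
    (hg₀ : g x₀ = g₀) (hb : 0 ≤ b) (hbγ : b < 1 / (p * γ))
    (hbound : ∀ y, ((g₀ - inner ℝ (∇ f x₀) (y - x₀) - b * ‖x₀ - y‖ ^ p : ℝ) : EReal) ≤ g y) :
    ∃ r : ℝ, 0 < r ∧ ∃ η : ℝ, 0 < η ∧ ∃ C : ℝ, 0 < C ∧ ∀ x ∈ Metric.ball x₀ r,
      ∀ v ∈ frechetSubdifferential (hifbe f g p γ) x,
        |(hifbe f g p γ x).toReal - (hifbe f g p γ x₀).toReal| < η →
        |(hifbe f g p γ x).toReal - (hifbe f g p γ x₀).toReal| ^ θ ≤ C * ‖v‖ := by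
  have hp := hfmaj.1
  have hp0 : 0 < p := by linarith
  have hθ0 : 0 < θ := lt_of_lt_of_le (div_pos (by linarith) hp0) hθ
  have hθ1 : θ < 1 := hKL.2.2.2.2.1
  have hfg := hfmaj.continuous_gradient hf
  obtain ⟨r₁, hr₁, η, hη, C, hC, H⟩ := hKL.exists_rpow_le hθ0
  obtain ⟨κ, hκ, r₂, hr₂, hstep⟩ := exists_mul_rpow_le_norm_subgradient hp hγ hfmaj.2.1 hγL hg
    (hfmaj.le hf) hf2
  set a := 1 / (p * γ) with ha
  have ha0 : 0 < a := by positivity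
  -- The four bounds put `(x, y)` in the KL ball of `ell`, put both points in the ball of the step
  -- estimate, force `‖x - y‖ ≤ 1`, and keep the proximal term below `η / 2`.
  set ρ := min (min (r₁ / 2) r₂) (min (1 / 2) (η / (8 * a))) with hρ
  have hρ0 : 0 < ρ := by positivity
  have hρ₁ : ρ ≤ r₁ / 2 := (min_le_left _ _).trans (min_le_left _ _)
  have hρ₂ : ρ ≤ r₂ := (min_le_left _ _).trans (min_le_right _ _)
  have hρ₃ : ρ ≤ 1 / 2 := (min_le_right _ _).trans (min_le_left _ _)
  have hρ₄ : ρ ≤ η / (8 * a) := (min_le_right _ _).trans (min_le_right _ _)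
  obtain ⟨r, hr, hball⟩ := Metric.eventually_nhds_iff.1
    ((eventually_forall_mem_hifbs_norm_sub_lt hp hf hf2 hg₀ hb hbγ hbound hρ0).and
      (Metric.ball_mem_nhds x₀ hρ0))
  refine ⟨r, hr, η / 2, by positivity, C * (1 + 2 / (γ * κ)) + a ^ θ / κ, by positivity,
    fun x hx v hv hτ => ?_⟩
  obtain ⟨hy', hxρ⟩ := hball (Metric.mem_ball.1 hx)
  obtain ⟨y, hy⟩ := hifbs_nonempty hp hfmaj.2.2.1 hfg hg hglsc hγ hlt x
  have hyρ := hy' y hy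
  rw [dist_eq_norm] at hxρ
  have hd : ‖x - y‖ < 2 * ρ := by
    rw [show x - y = (x - x₀) - (y - x₀) by abel]
    exact (norm_sub_le _ _).trans_lt (by linarith)
  have hstep := hstep x (by rw [Metric.mem_ball, dist_eq_norm]; linarith) y
    (by rw [Metric.mem_ball, dist_eq_norm]; linarith) v hv hy
  obtain ⟨G, hG⟩ := exists_coe_of_mem_hifbs hg hy
  have hd1 : ‖x - y‖ ≤ 1 := by linarith
  have hDp1 : ‖x - y‖ ^ p ≤ ‖x - y‖ := by
    simpa using Real.rpow_le_rpow_of_exponent_ge_of_imp (norm_nonneg (x - y)) hd1 hp.le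
      (fun _ h => absurd h hp0.ne')
  have hDη : a * ‖x - y‖ ^ p < η / 2 := by
    have h1 : a * ρ ≤ η / 8 := by
      calc a * ρ ≤ a * (η / (8 * a)) := mul_le_mul_of_nonneg_left hρ₄ ha0.le
        _ = η / 8 := by field_simp
    have h2 : a * ‖x - y‖ ^ p ≤ a * (2 * ρ) :=
      mul_le_mul_of_nonneg_left (hDp1.trans hd.le) ha0.le
    linarith
  have hD0 : 0 ≤ a * ‖x - y‖ ^ p := by positivity
  have hell : ell f g (WithLp.toLp 2 (x, y)) =
      ((f x + inner ℝ (∇ f x) (y - x) + G : ℝ) : EReal) := by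
    rw [EReal.coe_add, ← hG]; rfl
  have hell₀ : ell f g (WithLp.toLp 2 (x₀, x₀)) = ((f x₀ + g₀ : ℝ) : EReal) := by
    have : ell f g (WithLp.toLp 2 (x₀, x₀)) =
      ((f x₀ + inner ℝ (∇ f x₀) (x₀ - x₀) : ℝ) : EReal) + g x₀ := rfl
    rw [this, hg₀, ← EReal.coe_add]; simp
  have hx₀ : hifbe f g p γ x₀ = ((f x₀ + g₀ : ℝ) : EReal) := by
    rw [hifbe_eq_of_mem_hifbs (mem_hifbs_self hp hg₀ hbγ hbound), hifbModel_self hp hg₀]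
  have hxe : hifbe f g p γ x =
      ((f x + inner ℝ (∇ f x) (y - x) + G + a * ‖x - y‖ ^ p : ℝ) : EReal) := by
    rw [hifbe_eq_of_mem_hifbs hy, hifbModel, hell, ← EReal.coe_add]
  have Hxy := H (WithLp.toLp 2 (x, y)) (by
    rw [Metric.mem_ball, dist_eq_norm, ← WithLp.toLp_sub, Prod.mk_sub_mk]
    exact (norm_toLp_le _ _).trans_lt (by linarith)) _
    (toLp_mem_frechetSubdifferential_ell hp hγ hv hy)
  have hnorm := norm_toLp_sub_toLp_le hp hγ x y v
  rw [hell, hell₀, EReal.toReal_coe, EReal.toReal_coe] at Hxy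
  rw [hx₀, hxe, EReal.toReal_coe, EReal.toReal_coe] at hτ ⊢
  generalize f x + inner ℝ (∇ f x) (y - x) + G = e at *
  generalize f x₀ + g₀ = e₀ at *
  have hτ' : |e - e₀| < η := by
    rw [show e - e₀ = (e + a * ‖x - y‖ ^ p - e₀) - a * ‖x - y‖ ^ p by ring]
    refine (abs_sub _ _).trans_lt ?_
    rw [abs_of_nonneg hD0]; linarith
  have h1 := (Hxy hτ').trans (mul_le_mul_of_nonneg_left hnorm hC.le)
  have h2 : |e + a * ‖x - y‖ ^ p - e₀| ^ θ ≤ |e - e₀| ^ θ + (a * ‖x - y‖ ^ p) ^ θ := by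
    refine (Real.rpow_le_rpow (abs_nonneg _) ?_ hθ0.le).trans
      (Real.rpow_add_le_add_rpow (abs_nonneg _) hD0 hθ0.le hθ1.le)
    rw [show e + a * ‖x - y‖ ^ p - e₀ = (e - e₀) + a * ‖x - y‖ ^ p by ring]
    exact (abs_add_le _ _).trans (by rw [abs_of_nonneg hD0])
  -- The lower bound on `θ` enters here: `p * θ ≥ p - 1` and `‖x - y‖ ≤ 1`.
  have h3 : (a * ‖x - y‖ ^ p) ^ θ ≤ a ^ θ * ‖x - y‖ ^ (p - 1) := by
    rw [Real.mul_rpow ha0.le (by positivity), ← Real.rpow_mul (norm_nonneg _)]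
    refine mul_le_mul_of_nonneg_left ?_ (by positivity)
    refine Real.rpow_le_rpow_of_exponent_ge_of_imp (norm_nonneg _) hd1 ?_
      (fun _ h => absurd h (by positivity))
    rw [div_le_iff₀ hp0] at hθ; linarith
  have h4 : ‖x - y‖ ^ (p - 1) ≤ ‖v‖ / κ := by
    rw [le_div_iff₀ hκ]; linarith
  calc |e + a * ‖x - y‖ ^ p - e₀| ^ θ
      ≤ C * (‖v‖ + 2 / γ * ‖x - y‖ ^ (p - 1)) + a ^ θ * ‖x - y‖ ^ (p - 1) := by linarith
    _ ≤ C * (‖v‖ + 2 / γ * (‖v‖ / κ)) + a ^ θ * (‖v‖ / κ) := by gcongr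
    _ = (C * (1 + 2 / (γ * κ)) + a ^ θ / κ) * ‖v‖ := by field_simp

/-- The envelope of `f + g` inherits the Kurdyka-Łojasiewicz exponent of `ell` at fixed points of
the forward-backward splitting mapping. -/
lemma klExponentAt_hifbe [ProperSpace V] {f : V → ℝ} {g : V → EReal}
    {p L γ γ' θ : ℝ} {x₀ : V} (hf : Differentiable ℝ f) (hfmaj : HasHighOrderMajorant f p L)
    (hg : IsProper g) (hglsc : LowerSemicontinuous g) (hθ : (p - 1) / p ≤ θ)
    (hKL : x₀ ∈ frechetCritical (objective f g) →
      WithLp.toLp 2 (x₀, x₀) ∈ domSubdifferential (ell f g) →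
        KLExponentAt (ell f g) (WithLp.toLp 2 (x₀, x₀)) θ) (hf2 : ContDiffAt ℝ 2 f x₀)
    (hγ : 0 < γ) (hγL : γ < L⁻¹) (hlt : (γ : EReal) < proxThreshold g p) (hγ' : γ < γ')
    (hx₀ : x₀ ∈ proxFixedPoints f g p γ') :
    KLExponentAt (hifbe f g p γ) x₀ θ := by
  have hp := hfmaj.1
  have hp0 : 0 < p := by linarith
  have hfg := hfmaj.continuous_gradient hf
  have hγ'0 : 0 < γ' := hγ.trans hγ'
  obtain ⟨g₀, hg₀, hbound⟩ := exists_lower_bound_of_mem_proxFixedPoints hp hg hx₀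
  have hb : 0 ≤ 1 / (p * γ') := by positivity
  have hbγ : 1 / (p * γ') < 1 / (p * γ) :=
    one_div_lt_one_div_of_lt (by positivity) (mul_lt_mul_of_pos_left hγ' hp0)
  have hmem := mem_hifbs_self hp hg₀ hbγ hbound
  have hzero := zero_mem_frechetSubdifferential_hifbe hp hf hf2 hg₀ hb hbγ hbound
  have hself : ∀ y, hifbModel f g p γ y y = objective f g y := fun y => by
    rw [hifbModel_eq, objective]
    simp [Real.zero_rpow hp0.ne']
  -- Choosing `y = x` in the infimum puts the envelope below the objective, with equality at `x₀`,
  -- so the zero subgradient carries over.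
  have hcrit : x₀ ∈ frechetCritical (objective f g) :=
    frechetSubdifferential_subset_of_le
      (fun y => (hifbe_le_hifbModel f g p γ y y).trans_eq (hself y))
      ((hifbe_eq_of_mem_hifbs hmem).trans (hself x₀)) hzero
  have hKL := hKL hcrit ⟨_, frechetSubdifferential_subset_limitingSubdifferential _ _
    (toLp_mem_frechetSubdifferential_ell hp hγ hzero hmem)⟩
  have hθ0 : 0 < θ := lt_of_lt_of_le (div_pos (by linarith) hp0) hθ
  have hθ1 : θ < 1 := hKL.2.2.2.2.1
  obtain ⟨r, hr, η, hη, C, hC, H⟩ := exists_rpow_le_of_klExponentAt_ell hf hfmaj hg hglsc hθ hKL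
    hf2 hγ hγL hlt hg₀ hb hbγ hbound
  exact ⟨isProper_hifbe hp hfmaj.2.2.1 hfg hg hglsc hγ hlt,
    lowerSemicontinuous_hifbe hp hfmaj.2.2.1 hfg hg hglsc hγ hlt,
    ⟨0, frechetSubdifferential_subset_limitingSubdifferential _ _ hzero⟩, hθ0.le, hθ1,
    exists_klInequality_of_rpow_le hθ0 hθ1 hr hη hC H⟩

end HiFB

theorem proposition5p5 (n : ℕ) (p L θ : ℝ)
    (f : EuclideanSpace ℝ (Fin n) → ℝ) (g : EuclideanSpace ℝ (Fin n) → EReal)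
    (hf : Differentiable ℝ f)
    (hfmaj : HiFB.HasHighOrderMajorant f p L)
    (hg : HiFB.IsProper g) (hglsc : LowerSemicontinuous g)
    (hgpb : HiFB.HighOrderProxBounded g p)
    (hmin : ∃ xstar, ∀ x, HiFB.objective f g xstar ≤ HiFB.objective f g x)
    (hθ : θ ∈ Set.Ico ((p - 1) / p) 1)
    (hKL : ∀ x ∈ HiFB.frechetCritical (HiFB.objective f g),
      WithLp.toLp 2 (x, x) ∈ HiFB.domSubdifferential (HiFB.ell f g) →
        HiFB.KLExponentAt (HiFB.ell f g) (WithLp.toLp 2 (x, x)) θ)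
    (γhat : ℝ) (hγhat : 0 < γhat)
    (xbar : EuclideanSpace ℝ (Fin n))
    (hxbar : xbar ∈ HiFB.proxFixedPoints f g p γhat)
    (hf2 : ContDiffAt ℝ 2 f xbar)
    (γ : ℝ) (hγ : 0 < γ)
    (hγlt : (γ : EReal) <
      min (min ((L⁻¹ : ℝ) : EReal) (HiFB.proxThreshold g p)) (γhat : EReal)) :
    HiFB.KLExponentAt (HiFB.hifbe f g p γ) xbar θ := by
  have h1 := lt_min_iff.1 hγlt
  have h2 := lt_min_iff.1 h1.1
  exact HiFB.klExponentAt_hifbe hf hfmaj hg hglsc hθ.1 (hKL xbar) hf2 hγ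
    (EReal.coe_lt_coe_iff.1 h2.1) h2.2 (EReal.coe_lt_coe_iff.1 h1.2) hxbar
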